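/- All graphs are finite, simple and undirected. For a connected graph $G$ with vertices $v_1,\dots,v_n$, let $D(G)=(d_G(v_i,v_j))_{i,j}$ be its distance matrix, where $d_G(u,v)$ is the length of a shortest path between $u$ and $v$ in $G$, and let the distance spectral radius $\rho(G)$ be the largest eigenvalue of the real symmetric matrix $D(G)$. For $n\ge 4$, let the kite graph $K_4^{(n)}$ be the graph of order $n$ obtained from the complete graph $K_4$ by attaching a path of length $n-4$ at one of its vertices (that is, one end-vertex of the path is identified with that vertex). **Lemma.** If $G$ is a connected graph of order $n$ with maximum degree $\Delta(G)\ge 5$, then $$\rho(G)<\rho\bigl(K_4^{(n)}\bigr).$$ -/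

import Mathlib

/-- The distance matrix of a (connected) graph: the `(u, v)` entry is the length of a shortest
path between `u` and `v`. -/
noncomputable def SimpleGraph.distMatrix {V : Type*} (G : SimpleGraph V) : Matrix V V ℝ :=
  Matrix.of fun u v => (G.dist u v : ℝ)

theorem SimpleGraph.distMatrix_isHermitian {V : Type*} (G : SimpleGraph V) :
    G.distMatrix.IsHermitian := by
  ext u v
  simp [SimpleGraph.distMatrix, SimpleGraph.dist_comm]

/-- The distance spectral radius: the largest (real) eigenvalue of the distance matrix.
For a nonempty vertex set the supremum is attained, see `distSpectralRadius_isGreatest`. -/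
noncomputable def SimpleGraph.distSpectralRadius {V : Type*} [Fintype V] [DecidableEq V]
    (G : SimpleGraph V) : ℝ :=
  sSup (spectrum ℝ G.distMatrix)

theorem SimpleGraph.distSpectralRadius_isGreatest {V : Type*} [Fintype V] [DecidableEq V]
    [Nonempty V] (G : SimpleGraph V) :
    IsGreatest (spectrum ℝ G.distMatrix) G.distSpectralRadius := by
  have h := G.distMatrix_isHermitian.spectrum_real_eq_range_eigenvalues
  have hfin : (spectrum ℝ G.distMatrix).Finite := h ▸ Set.finite_range _
  have hne : (spectrum ℝ G.distMatrix).Nonempty := h ▸ Set.range_nonempty _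
  exact ⟨hne.csSup_mem hfin, fun _ hx => le_csSup hfin.bddAbove hx⟩

/-- The kite graph of order `n` (for `1 ≤ k ≤ n`): the vertices `0, …, k - 1` form a `k`-clique,
and the path `k - 1, k, …, n - 1` of length `n - k` is attached to it at the vertex `k - 1`. -/
def kiteGraph (k n : ℕ) : SimpleGraph (Fin n) where
  Adj i j := i ≠ j ∧ ((i.val < k ∧ j.val < k) ∨ i.val + 1 = j.val ∨ j.val + 1 = i.val)
  symm := ⟨fun i j h => ⟨h.1.symm, by omega⟩⟩
  loopless := ⟨fun _ h => h.1 rfl⟩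

/-!
Let `x` be the positive Perron vector of the distance matrix of `G`. It suffices to place the
weights `x u` on the vertices of the kite so that the energy `∑ d(u, v) x u x v` increases. Fix a
breadth-first tree rooted at a vertex `r` of maximum degree. Since `d(u, v) ≤ d(par u, v) + 1`,
merging a leaf `l` into its parent `w` lowers the energy by at most `2 x l` times the total weight
of the other vertices. If `l` is the lighter of two leaves, the merged weights can be placed on a
smaller kite by induction, and splitting `x w + x l` there into neighbouring vertices gains at
least as much.

The induction keeps at least five children of `r` and at least seven vertices. It stops at brooms,
with four leaves and a path hanging at `r`, and at the star with seven vertices; both are compared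
with explicit kites. A graph of order six has a vertex adjacent to all others, and the value
`43 / 5` separates its spectral radius from that of the kite.
-/

section Energy

/-- Half the distance energy `∑ d(i, j) yᵢ yⱼ` of a path whose consecutive vertices carry the
weights `m, y₁, y₂, …`, as the sum over the edges of the product of the masses on their two
sides. -/
def pathEnergy (m : ℝ) : List ℝ → ℝ
  | [] => 0
  | y :: ys => m * (y + ys.sum) + pathEnergy (m + y) ys

theorem pathEnergy_split (m w l : ℝ) (xs ys : List ℝ) :
    pathEnergy m (xs ++ w :: l :: ys) =
      pathEnergy m (xs ++ (w + l) :: ys) + (m + xs.sum + w) * (l + ys.sum) := by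
  induction xs generalizing m with
  | nil => simp only [List.nil_append, pathEnergy, List.sum_cons, List.sum_nil, ← add_assoc]; ring
  | cons x xs ih =>
    simp only [List.cons_append, pathEnergy, List.sum_append, List.sum_cons, ih]
    ring

theorem pathEnergy_append_zero (m : ℝ) (ys : List ℝ) :
    pathEnergy m (ys ++ [0]) = pathEnergy m ys := by
  induction ys generalizing m with
  | nil => simp [pathEnergy]
  | cons y ys ih => simp [pathEnergy, ih]

theorem pathEnergy_add_le_exchange (m : ℝ) {ys : List ℝ} (hys : ∀ y ∈ ys, 0 ≤ y) {z b : ℝ}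
    (hzb : z ≤ b) :
    pathEnergy (m + b) (ys ++ [z]) + (b - z) * (ys.length * (m - ys.sum) + m + ys.sum) ≤
      pathEnergy (m + z) (ys ++ [b]) := by
  induction ys generalizing m with
  | nil =>
    simp only [List.nil_append, pathEnergy, List.sum_nil, List.length_nil, Nat.cast_zero]
    linarith
  | cons y ys ih =>
    obtain ⟨hy, hys⟩ := List.forall_mem_cons.1 hys
    have tail := ih (m + y) hys
    have gain : 0 ≤ (b - z) * (ys.length * y) :=
      mul_nonneg (sub_nonneg.2 hzb) (mul_nonneg (Nat.cast_nonneg _) hy)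
    simp only [List.cons_append, pathEnergy, List.sum_append, List.sum_cons, List.sum_nil,
      List.length_cons, Nat.cast_add, Nat.cast_one, add_right_comm m _ y]
    linarith

/-- Half the distance energy of a kite with a `4`-clique: `a, b, c` are the weights of the clique
vertices off the path, and `ps` lists the weights along the path, from the clique outwards. -/
def kiteEnergy (a b c : ℝ) (ps : List ℝ) : ℝ :=
  a * b + a * c + b * c + pathEnergy (a + b + c) ps

theorem kiteEnergy_swap_left (a b c : ℝ) (ps : List ℝ) :
    kiteEnergy a b c ps = kiteEnergy b a c ps := by
  rw [kiteEnergy, kiteEnergy, add_comm a b]; ring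

theorem kiteEnergy_swap_right (a b c : ℝ) (ps : List ℝ) :
    kiteEnergy a b c ps = kiteEnergy a c b ps := by
  rw [kiteEnergy, kiteEnergy, add_right_comm a b c]; ring

/-- Half the distance energy of a broom: leaves with weights `F` and a path with weights `ps` hang
at a vertex of weight `r`. For `ps = []` this is a star with centre `r`. -/
def broomEnergy (F : Multiset ℝ) (r : ℝ) (ps : List ℝ) : ℝ :=
  F.sum ^ 2 - (F.map (· ^ 2)).sum + pathEnergy F.sum (r :: ps)

theorem broomEnergy_cons_nil (F : Multiset ℝ) (p r : ℝ) :
    broomEnergy (p ::ₘ F) r [] = broomEnergy F r [p] := by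
  simp only [broomEnergy, pathEnergy, Multiset.sum_cons, Multiset.map_cons, List.sum_cons,
    List.sum_nil]
  ring

theorem broomEnergy_split (F : Multiset ℝ) (r w l : ℝ) (ps : List ℝ) :
    broomEnergy F r (ps ++ [w, l]) =
      broomEnergy F r (ps ++ [w + l]) + l * (w + (r + (F.sum + ps.sum))) := by
  have split := pathEnergy_split F.sum w l (r :: ps) []
  simp only [List.cons_append, List.sum_cons, List.sum_nil] at split
  rw [broomEnergy, broomEnergy, split]
  ring

end Energy

section Insertion

variable {w l b c m a : ℝ} {ps : List ℝ}

theorem kiteEnergy_insert_right {xs ys : List ℝ} (hl : l ≤ a + b + c + xs.sum + w)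
    (hys : 0 ≤ ys.sum) :
    kiteEnergy a b c (xs ++ (w + l) :: ys) + l * (w + (a + b + c + (xs ++ ys).sum)) ≤
      kiteEnergy a b c (xs ++ w :: l :: ys) := by
  simp only [kiteEnergy, pathEnergy_split, List.sum_append]
  linarith [mul_le_mul_of_nonneg_right hl hys]

theorem kiteEnergy_insert_left {xs ys : List ℝ} (hl : l ≤ w + ys.sum)
    (hxs : 0 ≤ a + b + c + xs.sum) :
    kiteEnergy a b c (xs ++ (w + l) :: ys) + l * (w + (a + b + c + (xs ++ ys).sum)) ≤
      kiteEnergy a b c (xs ++ l :: w :: ys) := by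
  simp only [kiteEnergy, pathEnergy_split, List.sum_append, add_comm w l]
  linarith [mul_le_mul_of_nonneg_left hl hxs]

theorem kiteEnergy_insert_clique (hl : l ≤ ps.sum) (hbc : 0 ≤ b + c) :
    kiteEnergy (w + l) b c ps + l * (w + (b + c + ps.sum)) ≤ kiteEnergy l b c (w :: ps) := by
  have mass : l + b + c + w = w + l + b + c := by ring
  simp only [kiteEnergy, pathEnergy, mass]
  linarith [mul_le_mul_of_nonneg_left hl hbc]

theorem kiteEnergy_le_exchange_last {z : ℝ} (hps : ∀ p ∈ ps, 0 ≤ p) (hzb : z ≤ b)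
    (hac : ps.sum ≤ a + c) :
    kiteEnergy a b c (ps ++ [z]) ≤ kiteEnergy a z c (ps ++ [b]) := by
  have exchange := pathEnergy_add_le_exchange (a + c) hps hzb
  have gain : 0 ≤ (b - z) * (ps.length * (a + c - ps.sum) + ps.sum) :=
    mul_nonneg (sub_nonneg.2 hzb) (add_nonneg (mul_nonneg (Nat.cast_nonneg _) (sub_nonneg.2 hac))
      (List.sum_nonneg hps))
  rw [kiteEnergy, kiteEnergy, add_right_comm a b, add_right_comm a z]
  linarith

theorem exists_kiteEnergy_insert_path {xs ys : List ℝ}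
    (h₀ : ∀ y ∈ w :: l :: a :: b :: c :: (xs ++ ys), 0 ≤ y)
    (hm : m ∈ a :: b :: c :: (xs ++ ys)) (hlm : l ≤ m) :
    ∃ qs : List ℝ, qs.Perm (w :: l :: (xs ++ ys)) ∧
      kiteEnergy a b c (xs ++ (w + l) :: ys) + l * (w + (a + b + c + (xs ++ ys).sum)) ≤
        kiteEnergy a b c qs := by
  simp only [List.forall_mem_cons, List.forall_mem_append] at h₀
  obtain ⟨hw, -, ha, hb, hc, hxs, hys⟩ := h₀
  have xs_nonneg := List.sum_nonneg hxs
  have ys_nonneg := List.sum_nonneg hys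
  have left : m ∈ a :: b :: c :: xs ∨ m ∈ ys := by simpa [or_assoc] using hm
  rcases left with hm | hm
  · refine ⟨xs ++ w :: l :: ys, ?_, kiteEnergy_insert_right ?_ ys_nonneg⟩
    · exact List.perm_middle.trans (List.perm_middle.cons w)
    · have : m ≤ (a :: b :: c :: xs).sum :=
        List.single_le_sum (by simp only [List.forall_mem_cons]; exact ⟨ha, hb, hc, hxs⟩) m hm
      simp only [List.sum_cons] at this
      linarith
  · refine ⟨xs ++ l :: w :: ys, ?_, kiteEnergy_insert_left ?_ (by positivity)⟩
    · exact (List.perm_middle.trans (List.perm_middle.cons l)).trans (List.Perm.swap w l _)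
    · linarith [List.single_le_sum hys m hm]

theorem exists_kiteEnergy_insert_clique_of_mem_clique (hps : ps ≠ [])
    (h₀ : ∀ y ∈ w :: l :: b :: c :: ps, 0 ≤ y) (hlb : l ≤ b) :
    ∃ a' b' c' ps', (a' :: b' :: c' :: ps').Perm (w :: l :: b :: c :: ps) ∧
      kiteEnergy (w + l) b c ps + l * (w + (b + c + ps.sum)) ≤ kiteEnergy a' b' c' ps' := by
  simp only [List.forall_mem_cons] at h₀
  obtain ⟨hw, -, hb, hc, hp⟩ := h₀
  rcases le_total l ps.sum with hlp | hpl
  · exact ⟨l, b, c, w :: ps, by grind, kiteEnergy_insert_clique hlp (by positivity)⟩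
  · -- The path is light: exchanging `b` with its end costs nothing and makes it heavy.
    obtain ⟨qs, z, rfl⟩ := (List.eq_nil_or_concat ps).resolve_left hps
    simp only [List.concat_eq_append, List.forall_mem_append, List.forall_mem_singleton,
      List.sum_append, List.sum_singleton] at hp hpl ⊢
    have qs_nonneg := List.sum_nonneg hp.1
    refine ⟨l, z, c, w :: (qs ++ [b]), by grind, ?_⟩
    have exchange : kiteEnergy (w + l) b c (qs ++ [z]) ≤ kiteEnergy (w + l) z c (qs ++ [b]) :=
      kiteEnergy_le_exchange_last hp.1 (by linarith) (by linarith)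
    have insert := kiteEnergy_insert_clique (w := w) (l := l) (b := z) (c := c) (ps := qs ++ [b])
      (by simp only [List.sum_append, List.sum_singleton]; linarith) (by linarith)
    simp only [List.sum_append, List.sum_singleton] at insert
    linarith

theorem exists_kiteEnergy_insert_clique (hps : ps ≠ [])
    (h₀ : ∀ y ∈ w :: l :: b :: c :: ps, 0 ≤ y) (hm : m ∈ b :: c :: ps) (hlm : l ≤ m) :
    ∃ a' b' c' ps', (a' :: b' :: c' :: ps').Perm (w :: l :: b :: c :: ps) ∧
      kiteEnergy (w + l) b c ps + l * (w + (b + c + ps.sum)) ≤ kiteEnergy a' b' c' ps' := by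
  rcases List.mem_cons.1 hm with rfl | hm
  · exact exists_kiteEnergy_insert_clique_of_mem_clique hps h₀ hlm
  rcases List.mem_cons.1 hm with rfl | hm
  · obtain ⟨a', b', c', ps', perm, le⟩ := exists_kiteEnergy_insert_clique_of_mem_clique
      (w := w) (b := m) (c := b) hps (by grind) hlm
    refine ⟨a', b', c', ps', by grind, ?_⟩
    rwa [kiteEnergy_swap_right, add_comm b]
  · simp only [List.forall_mem_cons] at h₀
    obtain ⟨-, -, hb, hc, hp⟩ := h₀
    exact ⟨l, b, c, w :: ps, by grind,
      kiteEnergy_insert_clique (hlm.trans (List.single_le_sum hp m hm)) (by positivity)⟩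

theorem exists_kiteEnergy_insert {zs : Multiset ℝ} (hps : ps ≠ [])
    (h : ((a :: b :: c :: ps : List ℝ) : Multiset ℝ) = (w + l) ::ₘ zs)
    (h₀ : ∀ y ∈ w ::ₘ l ::ₘ zs, 0 ≤ y) (hm : m ∈ zs) (hlm : l ≤ m) :
    ∃ a' b' c' ps', ((a' :: b' :: c' :: ps' : List ℝ) : Multiset ℝ) = w ::ₘ l ::ₘ zs ∧
      kiteEnergy a b c ps + l * (w + zs.sum) ≤ kiteEnergy a' b' c' ps' := by
  have clique : ∀ b' c', (a :: b :: c :: ps).Perm ((w + l) :: b' :: c' :: ps) →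
      kiteEnergy a b c ps = kiteEnergy (w + l) b' c' ps →
      ∃ a' b' c' ps', ((a' :: b' :: c' :: ps' : List ℝ) : Multiset ℝ) = w ::ₘ l ::ₘ zs ∧
        kiteEnergy a b c ps + l * (w + zs.sum) ≤ kiteEnergy a' b' c' ps' := by
    intro b' c' perm energy
    obtain rfl : zs = ((b' :: c' :: ps : List ℝ) : Multiset ℝ) :=
      (Multiset.cons_inj_right (w + l)).1 (h.symm.trans (Multiset.coe_eq_coe.2 perm))
    obtain ⟨a'', b'', c'', ps'', perm', le⟩ :=
      exists_kiteEnergy_insert_clique (w := w) hps h₀ hm hlm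
    refine ⟨a'', b'', c'', ps'', Multiset.coe_eq_coe.2 perm', ?_⟩
    rw [energy]
    simpa [← add_assoc] using le
  have mem : w + l ∈ a :: b :: c :: ps := by
    rw [← Multiset.mem_coe, h]; exact Multiset.mem_cons_self _ _
  simp only [List.mem_cons] at mem
  rcases mem with rfl | rfl | rfl | mem
  · exact clique b c .rfl rfl
  · exact clique a c (.swap _ _ _) (kiteEnergy_swap_left ..)
  · exact clique a b (by grind) (by rw [kiteEnergy_swap_right, kiteEnergy_swap_left])
  · obtain ⟨xs, ys, rfl⟩ := List.append_of_mem mem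
    obtain rfl : zs = ((a :: b :: c :: (xs ++ ys) : List ℝ) : Multiset ℝ) := by
      refine (Multiset.cons_inj_right (w + l)).1 (h.symm.trans (Multiset.coe_eq_coe.2 ?_))
      grind
    obtain ⟨qs, perm, le⟩ := exists_kiteEnergy_insert_path (w := w) h₀ hm hlm
    refine ⟨a, b, c, qs, Multiset.coe_eq_coe.2 (by grind), ?_⟩
    simpa [add_assoc] using le

end Insertion

section BaseCases

theorem kiteEnergy_cons_cons_eq_broomEnergy_add (a b c e r : ℝ) (ps : List ℝ) :
    kiteEnergy a b c (r :: e :: ps) =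
      broomEnergy {a, b, c, e} r ps + ((a + b + c + r - e) * ps.sum - (a * b + a * c + b * c)) := by
  have mass : a + b + c + r + e = a + (b + (c + e)) + r := by ring
  simp only [kiteEnergy, broomEnergy, pathEnergy, Multiset.insert_eq_cons, Multiset.sum_cons,
    Multiset.sum_singleton, Multiset.map_cons, Multiset.map_singleton, List.sum_cons, mass]
  ring

theorem broomEnergy_add_le_kiteEnergy_concat {a b c e r : ℝ} {ps : List ℝ} (ha : 0 ≤ a)
    (hps : ∀ p ∈ ps, 0 ≤ p) :
    broomEnergy {a, b, c, e} r ps +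
        (ps.length * a * (e + b + c + r - ps.sum) - (e * b + e * c + b * c)) ≤
      kiteEnergy e b c (r :: (ps ++ [a])) := by
  have exchange := pathEnergy_add_le_exchange (e + b + c + r) hps ha
  have mass : a + (b + (c + e)) + r = e + b + c + r + a := by ring
  simp only [pathEnergy_append_zero, add_zero] at exchange
  simp only [kiteEnergy, broomEnergy, pathEnergy, Multiset.insert_eq_cons, Multiset.sum_cons,
    Multiset.sum_singleton, Multiset.map_cons, Multiset.map_singleton, List.sum_cons,
    List.sum_append, List.sum_nil, mass]
  linarith

theorem broom_inequality {a b c e : ℝ} (hba : b ≤ a) (hca : c ≤ a) (heb : e ≤ b) (hec : e ≤ c)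
    (he : 0 ≤ e) :
    2 * a * (a * b + a * c + b * c) ≤
      (a + b + c - e) * (2 * a * (e + b + c) - (e * b + e * c + b * c)) := by
  have pair : 0 ≤ b + c - 2 * e := by linarith
  have excess : 0 ≤ 2 * a - (b + c) := by linarith
  have third : 0 ≤ 3 * a + (b + c - e) := by linarith
  suffices 0 ≤ 3 * (b + c) ^ 2 * (b + c - 2 * e) +
      (2 * a - (b + c)) * (4 * e * (b + c - 2 * e) + 5 * (b + c) ^ 2) +
      4 * e * (2 * a - (b + c)) ^ 2 + 2 * (3 * a + (b + c - e)) * (b - c) ^ 2 by linarith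
  positivity

theorem broomEnergy_lt_kiteEnergy {a b c e r : ℝ} {ps : List ℝ} (hba : b ≤ a) (hca : c ≤ a)
    (heb : e ≤ b) (hec : e ≤ c) (he : 0 < e) (hr : 0 < r) (hps : ∀ p ∈ ps, 0 ≤ p)
    (hlen : 2 ≤ ps.length) :
    broomEnergy {a, b, c, e} r ps < kiteEnergy a b c (r :: e :: ps) ∨
      broomEnergy {a, b, c, e} r ps < kiteEnergy e b c (r :: (ps ++ [a])) := by
  have ha : 0 < a := by linarith
  by_contra! ⟨middle, last⟩
  rw [kiteEnergy_cons_cons_eq_broomEnergy_add] at middle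
  replace last := (broomEnergy_add_le_kiteEnergy_concat ha.le hps).trans last
  have heavy_path : 2 * a * (e + b + c + r) - (e * b + e * c + b * c) ≤ 2 * a * ps.sum := by
    have pairs_pos : 0 < e * b + e * c + b * c := by
      have hb : 0 < b := by linarith
      have hc : 0 < c := by linarith
      positivity
    have two_le : (2 : ℝ) ≤ ps.length := by exact_mod_cast hlen
    rcases le_total 0 (a * (e + b + c + r - ps.sum)) with h | h
    · linarith [mul_le_mul_of_nonneg_right two_le h]
    · linarith
  have pairs_lt : e * b + e * c + b * c < 2 * a * (e + b + c) := by
    nlinarith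
  have gain : 2 * a * (a * b + a * c + b * c) < (a + b + c + r - e) * (2 * a * ps.sum) :=
    calc 2 * a * (a * b + a * c + b * c)
      _ ≤ (a + b + c - e) * (2 * a * (e + b + c) - (e * b + e * c + b * c)) :=
        broom_inequality hba hca heb hec he.le
      _ < (a + b + c + r - e) * (2 * a * (e + b + c) - (e * b + e * c + b * c)) :=
        mul_lt_mul_of_pos_right (by linarith) (by linarith)
      _ ≤ (a + b + c + r - e) * (2 * a * ps.sum) :=
        mul_le_mul_of_nonneg_left (by linarith [mul_pos ha hr]) (by linarith)
  have : 2 * a * (a * b + a * c + b * c) < 2 * a * ((a + b + c + r - e) * ps.sum) := by linarith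
  linarith [lt_of_mul_lt_mul_left this (by linarith)]

theorem exists_broomEnergy_lt_kiteEnergy {F : Multiset ℝ} (hF : F.card = 4) (hF₀ : ∀ y ∈ F, 0 < y)
    {r : ℝ} (hr : 0 < r) {ps : List ℝ} (hps : ∀ p ∈ ps, 0 ≤ p) (hlen : 2 ≤ ps.length) :
    ∃ a b c qs, ((a :: b :: c :: qs : List ℝ) : Multiset ℝ) = r ::ₘ (F + ps) ∧
      broomEnergy F r ps < kiteEnergy a b c qs := by
  obtain ⟨a, b, c, e, sorted⟩ : ∃ a b c e, F.sort (· ≥ ·) = [a, b, c, e] :=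
    List.length_eq_four.1 (by rw [Multiset.length_sort, hF])
  have order := F.pairwise_sort (· ≥ ·)
  obtain rfl : F = {a, b, c, e} := by rw [← F.sort_eq (· ≥ ·), sorted]; rfl
  simp only [sorted, List.pairwise_cons, List.forall_mem_cons] at order
  rcases broomEnergy_lt_kiteEnergy order.1.1 order.1.2.1 order.2.1.2.1 order.2.2.1.1
    (hF₀ e (by simp)) hr hps hlen with middle | last
  · exact ⟨a, b, c, r :: e :: ps, Multiset.coe_eq_coe.2 (by grind), middle⟩
  · exact ⟨e, b, c, r :: (ps ++ [a]), Multiset.coe_eq_coe.2 (by grind), last⟩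

theorem broomEnergy_nil_lt_kiteEnergy {g a b c f e r : ℝ} (hag : a ≤ g) (hba : b ≤ a) (hcb : c ≤ b)
    (hfc : f ≤ c) (hef : e ≤ f) (he : 0 < e) (hr : 0 < r) :
    broomEnergy {g, a, b, c, f, e} r [] < kiteEnergy a b c [r, f, e, g] := by
  simp only [kiteEnergy, broomEnergy, pathEnergy, Multiset.insert_eq_cons, Multiset.sum_cons,
    Multiset.sum_singleton, Multiset.map_cons, Multiset.map_singleton, List.sum_cons, List.sum_nil]
  have hg : 0 < g := by linarith
  have hb : 0 < b := by linarith
  have hc : 0 < c := by linarith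
  have ha : 0 < a := by linarith
  linarith [mul_le_mul_of_nonneg_right hag hb.le,
    mul_le_mul_of_nonneg_left (hcb.trans (hba.trans hag)) ha.le,
    mul_le_mul_of_nonneg_right (hba.trans hag) hc.le,
    mul_le_mul_of_nonneg_left (show e ≤ a by linarith) hg.le,
    mul_le_mul_of_nonneg_left (show f ≤ a by linarith) he.le, mul_pos hr he, mul_pos hr hg,
    mul_pos hb he, mul_pos hc he, mul_pos hg hb, mul_pos hg hc]

theorem exists_broomEnergy_nil_lt_kiteEnergy {F : Multiset ℝ} (hF : F.card = 6)
    (hF₀ : ∀ y ∈ F, 0 < y) {r : ℝ} (hr : 0 < r) :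
    ∃ a b c qs, ((a :: b :: c :: qs : List ℝ) : Multiset ℝ) = r ::ₘ F ∧
      broomEnergy F r [] < kiteEnergy a b c qs := by
  obtain ⟨g, a, b, c, f, e, sorted⟩ : ∃ g a b c f e, F.sort (· ≥ ·) = [g, a, b, c, f, e] :=
    match F.sort (· ≥ ·), (F.length_sort _).trans hF with
    | [g, a, b, c, f, e], _ => ⟨g, a, b, c, f, e, rfl⟩
  have order := F.pairwise_sort (· ≥ ·)
  obtain rfl : F = {g, a, b, c, f, e} := by rw [← F.sort_eq (· ≥ ·), sorted]; rfl
  simp only [sorted, List.pairwise_cons, List.forall_mem_cons] at order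
  obtain ⟨⟨hag, -⟩, ⟨hba, -⟩, ⟨hcb, -⟩, ⟨hfc, -⟩, ⟨hef, -⟩, -⟩ := order
  exact ⟨a, b, c, [r, f, e, g], Multiset.coe_eq_coe.2 (by grind),
    broomEnergy_nil_lt_kiteEnergy hag hba hcb hfc hef (hF₀ e (by simp)) hr⟩

end BaseCases

section MatrixEnergy

variable {V : Type*} {D : Matrix V V ℝ} {s : Finset V} {l w : V} {x : V → ℝ}

/-- The energy `∑ D u v * x u * x v` over ordered pairs of points of `s`, where `D` is thought of as
a distance matrix and `x` as a system of weights. -/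
def distEnergy (D : Matrix V V ℝ) (s : Finset V) (x : V → ℝ) : ℝ :=
  ∑ u ∈ s, ∑ v ∈ s, D u v * (x u * x v)

theorem distEnergy_congr {y : V → ℝ} (h : ∀ u ∈ s, x u = y u) :
    distEnergy D s x = distEnergy D s y :=
  Finset.sum_congr rfl fun u hu => Finset.sum_congr rfl fun v hv => by rw [h u hu, h v hv]

section Insert

variable [DecidableEq V]

theorem distEnergy_insert (hD : D.IsSymm) (hl : l ∉ s) (hll : D l l = 0) :
    distEnergy D (insert l s) x = distEnergy D s x + 2 * (x l * ∑ v ∈ s, D l v * x v) := by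
  have column : ∀ u, D u l = D l u := fun u => hD.apply l u
  simp only [distEnergy, Finset.sum_insert hl, hll, Finset.sum_add_distrib, column,
    mul_comm _ (x l), mul_left_comm _ (x l), ← Finset.mul_sum]
  ring

theorem distEnergy_insert_eq_update_add (hD : D.IsSymm) (hw : w ∈ s) (hl : l ∉ s) (hll : D l l = 0)
    (hww : D w w = 0) :
    distEnergy D (insert l s) x = distEnergy D s (Function.update x w (x w + x l)) +
      2 * (x l * ∑ v ∈ s, (D l v - D w v) * x v) := by
  obtain ⟨t, hwt, rfl⟩ : ∃ t, w ∉ t ∧ insert w t = s :=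
    ⟨s.erase w, Finset.notMem_erase w s, Finset.insert_erase hw⟩
  have off : ∀ v ∈ t, Function.update x w (x w + x l) v = x v := fun v hv =>
    Function.update_of_ne (ne_of_mem_of_not_mem hv hwt) ..
  have column : ∑ v ∈ t, D w v * Function.update x w (x w + x l) v = ∑ v ∈ t, D w v * x v :=
    Finset.sum_congr rfl fun v hv => by rw [off v hv]
  rw [distEnergy_insert hD hl hll, distEnergy_insert hD hwt hww, distEnergy_insert hD hwt hww,
    distEnergy_congr off, column, Function.update_self, Finset.sum_insert hwt,
    Finset.sum_insert hwt, hww]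
  simp only [sub_mul, Finset.sum_sub_distrib]
  ring

theorem distEnergy_insert_le_update_add (hD : D.IsSymm) (hw : w ∈ s) (hl : l ∉ s) (hll : D l l = 0)
    (hww : D w w = 0) (hlw : ∀ v ∈ s, D l v ≤ D w v + 1) (hxl : 0 ≤ x l) (hx : ∀ v ∈ s, 0 ≤ x v) :
    distEnergy D (insert l s) x ≤ distEnergy D s (Function.update x w (x w + x l)) +
      2 * (x l * ∑ v ∈ s, x v) := by
  have sum_le : ∑ v ∈ s, (D l v - D w v) * x v ≤ ∑ v ∈ s, x v :=
    Finset.sum_le_sum fun v hv => mul_le_of_le_one_left (hx v hv) (by linarith [hlw v hv])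
  rw [distEnergy_insert_eq_update_add hD hw hl hll hww]
  gcongr

theorem le_update_add {v : V} (hl : 0 ≤ x l) :
    x v ≤ Function.update x w (x w + x l) v := by
  rcases eq_or_ne v w with rfl | hvw
  · rw [Function.update_self]
    exact le_add_of_nonneg_right hl
  · rw [Function.update_of_ne hvw]

theorem map_update_val {z : ℝ} (hw : w ∈ s) :
    s.val.map (Function.update x w z) = z ::ₘ (s.erase w).val.map x := by
  rw [← Finset.insert_erase hw, Finset.insert_val_of_notMem (Finset.notMem_erase w s),
    Multiset.map_cons, Function.update_self, Finset.erase_insert (Finset.notMem_erase w s)]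
  refine congrArg _ (Multiset.map_congr rfl fun v hv => Function.update_of_ne ?_ ..)
  exact Finset.ne_of_mem_erase hv

theorem map_val_eq_cons_erase (hw : w ∈ s) : s.val.map x = x w ::ₘ (s.erase w).val.map x := by
  rw [← map_update_val hw, Function.update_eq_self]

end Insert

theorem distEnergy_le_of_le_two (hD : D.IsSymm) (hdiag : ∀ u ∈ s, D u u = 0)
    (h₂ : ∀ u ∈ s, ∀ v ∈ s, D u v ≤ 2) (hx : ∀ u ∈ s, 0 ≤ x u) :
    distEnergy D s x ≤ 2 * ((∑ u ∈ s, x u) ^ 2 - ∑ u ∈ s, x u ^ 2) := by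
  classical
  induction s using Finset.induction_on with
  | empty => simp [distEnergy]
  | insert u s hu ih =>
    simp only [Finset.forall_mem_insert] at hdiag h₂ hx
    have rest := ih hdiag.2 (fun v hv => (h₂.2 v hv).2) hx.2
    have column : ∑ v ∈ s, D u v * x v ≤ 2 * ∑ v ∈ s, x v := by
      rw [Finset.mul_sum]
      exact Finset.sum_le_sum fun v hv => mul_le_mul_of_nonneg_right (h₂.1.2 v hv) (hx.2 v hv)
    rw [distEnergy_insert hD hu hdiag.1, Finset.sum_insert hu, Finset.sum_insert hu]
    linarith [mul_le_mul_of_nonneg_left column hx.1]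

end MatrixEnergy

section HasBetterKite

variable {V : Type*} {D : Matrix V V ℝ} {s : Finset V} {l m w : V} {x : V → ℝ}

/-- The weights `x` on `s` can be placed bijectively on the vertices of a kite so that their energy
with respect to the distances of the kite exceeds the one with respect to `D`. -/
def HasBetterKite (D : Matrix V V ℝ) (s : Finset V) (x : V → ℝ) : Prop :=
  ∃ a b c ps, ((a :: b :: c :: ps : List ℝ) : Multiset ℝ) = s.val.map x ∧
    distEnergy D s x < 2 * kiteEnergy a b c ps

theorem HasBetterKite.insert [DecidableEq V]
    (h : HasBetterKite D s (Function.update x w (x w + x l))) (hs : 4 ≤ s.card) (hD : D.IsSymm)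
    (hw : w ∈ s) (hl : l ∉ s) (hll : D l l = 0) (hww : D w w = 0)
    (hlw : ∀ v ∈ s, D l v ≤ D w v + 1) (hx : ∀ v ∈ insert l s, 0 ≤ x v) (hm : m ∈ s) (hmw : m ≠ w)
    (hlm : x l ≤ x m) : HasBetterKite D (insert l s) x := by
  obtain ⟨a, b, c, ps, weights, lt⟩ := h
  have ps_ne_nil : ps ≠ [] := by
    rintro rfl
    have := congrArg Multiset.card weights
    simp only [Multiset.coe_card, Multiset.card_map, Finset.card_val, List.length_cons,
      List.length_nil] at this
    omega
  rw [map_update_val hw] at weights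
  have insert_weights :
      (Insert.insert l s).val.map x = x w ::ₘ x l ::ₘ (s.erase w).val.map x := by
    rw [Finset.insert_val_of_notMem hl, Multiset.map_cons, map_val_eq_cons_erase hw,
      Multiset.cons_swap]
  obtain ⟨a', b', c', ps', weights', le⟩ := exists_kiteEnergy_insert ps_ne_nil weights
    (fun y hy => by
      rw [← insert_weights] at hy
      obtain ⟨v, hv, rfl⟩ := Multiset.mem_map.1 hy
      exact hx v hv)
    (Multiset.mem_map_of_mem x (Finset.mem_erase.2 ⟨hmw, hm⟩)) hlm
  refine ⟨a', b', c', ps', weights'.trans insert_weights.symm, ?_⟩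
  have mass : x w + ((s.erase w).val.map x).sum = ∑ v ∈ s, x v :=
    Finset.add_sum_erase s x hw
  rw [mass] at le
  rw [Finset.forall_mem_insert] at hx
  linarith [distEnergy_insert_le_update_add hD hw hl hll hww hlw hx.1 hx.2]

end HasBetterKite

section RootedTree

open scoped Finset

variable {V : Type*} {D : Matrix V V ℝ} {r : V} {par : V → V} {dep : V → ℕ} {s : Finset V}
  {l t : V} {x : V → ℝ}

/-- A rooted tree with root `r`, given by the parent `par u` of each `u ≠ r` and the depth function
`dep`; the value `par r` is irrelevant. -/
structure IsRootedTree (r : V) (par : V → V) (dep : V → ℕ) : Prop where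
  dep_root : dep r = 0
  dep_eq : ∀ u ≠ r, dep u = dep (par u) + 1

/-- A set of nodes containing the root and closed under taking parents. -/
structure IsSubtree (r : V) (par : V → V) (s : Finset V) : Prop where
  root_mem : r ∈ s
  par_mem : ∀ u ∈ s, u ≠ r → par u ∈ s

/-- A rooted tree together with a symmetric matrix `D`, vanishing on the diagonal, whose entries
`D u v` grow by at most one from `par u` to `u`, as the distances of a graph do along the edges of
any of its rooted spanning trees. -/
structure IsRootedTreeFor (D : Matrix V V ℝ) (r : V) (par : V → V) (dep : V → ℕ) : Prop
    extends IsRootedTree r par dep where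
  isSymm : D.IsSymm
  diag : ∀ u, D u u = 0
  le_par_add_one : ∀ u ≠ r, ∀ v, D u v ≤ D (par u) v + 1

namespace IsRootedTree

theorem dep_eq_zero_iff (h : IsRootedTree r par dep) {u : V} : dep u = 0 ↔ u = r := by
  refine ⟨fun hu => ?_, fun hu => hu ▸ h.dep_root⟩
  by_contra hur
  simp [h.dep_eq u hur] at hu

theorem par_eq_root (h : IsRootedTree r par dep) {u : V} (hu : dep u = 1) : par u = r := by
  have hur : u ≠ r := by rintro rfl; simp [h.dep_root] at hu
  have := h.dep_eq u hur
  exact h.dep_eq_zero_iff.1 (by omega)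

end IsRootedTree

variable [DecidableEq V]

/-- The nodes of `s` other than the root that are not the parent of a node of `s`. -/
def treeLeaves (r : V) (par : V → V) (s : Finset V) : Finset V :=
  s.erase r \ (s.erase r).image par

theorem mem_treeLeaves :
    l ∈ treeLeaves r par s ↔ (l ≠ r ∧ l ∈ s) ∧ ∀ u ∈ s, u ≠ r → par u ≠ l := by
  simp only [treeLeaves, Finset.mem_sdiff, Finset.mem_erase, Finset.mem_image]
  grind

theorem IsSubtree.erase (hs : IsSubtree r par s) (hl : l ∈ treeLeaves r par s) :
    IsSubtree r par (s.erase l) := by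
  rw [mem_treeLeaves] at hl
  refine ⟨Finset.mem_erase.2 ⟨hl.1.1.symm, hs.root_mem⟩, fun u hu hur => ?_⟩
  rw [Finset.mem_erase] at hu ⊢
  exact ⟨hl.2 u hu.2 hur, hs.par_mem u hu.2 hur⟩

theorem IsSubtree.par_mem_erase (hs : IsSubtree r par s) (hl : l ∈ treeLeaves r par s) :
    par l ∈ s.erase l := by
  rw [mem_treeLeaves] at hl
  exact Finset.mem_erase.2 ⟨hl.2 l hl.1.2 hl.1.1, hs.par_mem l hl.1.2 hl.1.1⟩

theorem mem_treeLeaves_of_mem_erase {u : V} (hu : u ∈ treeLeaves r par (s.erase l))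
    (hul : u ≠ par l) : u ∈ treeLeaves r par s := by
  rw [mem_treeLeaves] at hu ⊢
  grind

namespace IsRootedTree

theorem exists_mem_treeLeaves_forall_dep_le (h : IsRootedTree r par dep) (hr : r ∈ s)
    (hs : s.Nontrivial) : ∃ l ∈ treeLeaves r par s, ∀ u ∈ s, dep u ≤ dep l := by
  obtain ⟨l, hl, deepest⟩ := (s.erase r).exists_max_image dep
    ((Finset.erase_nonempty hr).2 hs)
  rw [Finset.mem_erase] at hl
  refine ⟨l, mem_treeLeaves.2 ⟨hl, fun u hu hur hul => ?_⟩, fun u hu => ?_⟩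
  · have := deepest u (Finset.mem_erase.2 ⟨hur, hu⟩)
    rw [h.dep_eq u hur, hul] at this
    omega
  · rcases eq_or_ne u r with rfl | hur
    · simp [h.dep_root]
    · exact deepest u (Finset.mem_erase.2 ⟨hur, hu⟩)

theorem card_dep_one_le_card_treeLeaves (h : IsRootedTree r par dep) :
    #{u ∈ s | dep u = 1} ≤ #(treeLeaves r par s) := by
  have partition : s.erase r ⊆ treeLeaves r par s ∪
      {u ∈ s.erase r | ¬dep u = 1}.image par := by
    intro v hv
    rw [Finset.mem_union, treeLeaves, Finset.mem_sdiff]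
    by_contra! ⟨inner, outer⟩
    obtain ⟨u, hu, rfl⟩ := Finset.mem_image.1 (inner hv)
    refine outer (Finset.mem_image_of_mem par (Finset.mem_filter.2 ⟨hu, fun hu₁ => ?_⟩))
    exact Finset.ne_of_mem_erase hv (h.par_eq_root hu₁)
  have depth_one : {u ∈ s.erase r | dep u = 1} = {u ∈ s | dep u = 1} := by
    ext u
    simp only [Finset.mem_filter, Finset.mem_erase]
    refine ⟨fun hu => ⟨hu.1.2, hu.2⟩, fun hu => ⟨⟨?_, hu.1⟩, hu.2⟩⟩
    rintro rfl
    simp [h.dep_root] at hu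
  have card_le := (Finset.card_le_card partition).trans (Finset.card_union_le _ _)
  have image_le := Finset.card_image_le (s := {u ∈ s.erase r | ¬dep u = 1}) (f := par)
  have split := Finset.card_filter_add_card_filter_not (s := s.erase r) (fun u => dep u = 1)
  rw [depth_one] at split
  omega

end IsRootedTree

namespace IsRootedTreeFor

theorem distEnergy_le_broomEnergy_nil (h : IsRootedTreeFor D r par dep) (hr : r ∈ s)
    (hdep : ∀ u ∈ s, dep u ≤ 1) (hx : ∀ u ∈ s, 0 ≤ x u) :
    distEnergy D s x ≤ 2 * broomEnergy ((s.erase r).val.map x) (x r) [] := by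
  have star : ∀ u ∈ s.erase r, par u = r := fun u hu => by
    obtain ⟨hur, hu⟩ := Finset.mem_erase.1 hu
    exact h.par_eq_root (le_antisymm (hdep u hu) (Nat.one_le_iff_ne_zero.2
      fun hu₀ => hur (h.dep_eq_zero_iff.1 hu₀)))
  have le_add_one : ∀ u ∈ s.erase r, ∀ v, D u v ≤ D r v + 1 := fun u hu v => by
    simpa only [star u hu] using h.le_par_add_one u (Finset.ne_of_mem_erase hu) v
  have root_le : ∀ u ∈ s.erase r, D r u ≤ 1 := fun u hu => by
    simpa only [h.diag, zero_add, h.isSymm.apply u r] using le_add_one u hu r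
  have rim := distEnergy_le_of_le_two (D := D) (x := x) h.isSymm (fun u _ => h.diag u)
    (fun u hu v hv => by linarith [le_add_one u hu v, root_le v hv])
    (fun u hu => hx u (Finset.mem_of_mem_erase hu))
  have spokes : ∑ v ∈ s.erase r, D r v * x v ≤ ∑ v ∈ s.erase r, x v :=
    Finset.sum_le_sum fun v hv =>
      mul_le_of_le_one_left (hx v (Finset.mem_of_mem_erase hv)) (root_le v hv)
  rw [← Finset.insert_erase hr, distEnergy_insert h.isSymm (Finset.notMem_erase r s) (h.diag r),
    Finset.erase_insert (Finset.notMem_erase r s)]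
  simp only [broomEnergy, pathEnergy, Multiset.map_map, List.sum_nil]
  change _ ≤ 2 * ((∑ v ∈ s.erase r, x v) ^ 2 - (∑ v ∈ s.erase r, x v ^ 2) +
    ((∑ v ∈ s.erase r, x v) * (x r + 0) + 0))
  linarith [mul_le_mul_of_nonneg_left spokes (hx r hr)]

omit [DecidableEq V] in
theorem exists_distEnergy_le_broomEnergy_of_forall_dep_le_one (h : IsRootedTreeFor D r par dep)
    (hr : r ∈ s) (ht : t ∈ s) (htr : t ≠ r) (hdep : ∀ u ∈ s, dep u ≤ 1) (hx : ∀ u ∈ s, 0 ≤ x u) :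
    ∃ (F : Multiset ℝ) (ps : List ℝ), F.card + 1 = #{u ∈ s | dep u = 1} ∧
      s.val.map x = x r ::ₘ (F + ↑(ps ++ [x t])) ∧
      distEnergy D s x ≤ 2 * broomEnergy F (x r) (ps ++ [x t]) := by
  classical
  have ht' : t ∈ s.erase r := Finset.mem_erase.2 ⟨htr, ht⟩
  have depth_one : {u ∈ s | dep u = 1} = s.erase r := by
    ext u
    rw [Finset.mem_filter, Finset.mem_erase, and_comm, and_congr_left_iff]
    intro hu
    rw [ne_eq, ← h.dep_eq_zero_iff]
    have := hdep u hu
    omega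
  have rim := map_val_eq_cons_erase (x := x) ht'
  refine ⟨((s.erase r).erase t).val.map x, [], ?_, ?_, ?_⟩
  · rw [depth_one, Multiset.card_map, Finset.card_val, Finset.card_erase_add_one ht']
  · rw [map_val_eq_cons_erase hr, rim, List.nil_append, Multiset.coe_singleton,
      Multiset.add_comm, Multiset.singleton_add]
  · rw [List.nil_append, ← broomEnergy_cons_nil, ← rim]
    exact h.distEnergy_le_broomEnergy_nil hr hdep hx

theorem distEnergy_le_broomEnergy_concat {F : Multiset ℝ} {ps : List ℝ} {w : V}
    (h : IsRootedTreeFor D r par dep) (hw : w ∈ s) (ht : t ∉ s) (htr : t ≠ r) (htw : par t = w)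
    (hx : ∀ u ∈ insert t s, 0 ≤ x u)
    (weights : s.val.map (Function.update x w (x w + x t)) =
      x r ::ₘ (F + ↑(ps ++ [x w + x t])))
    (le : distEnergy D s (Function.update x w (x w + x t)) ≤
      2 * broomEnergy F (x r) (ps ++ [x w + x t])) :
    (insert t s).val.map x = x r ::ₘ (F + ↑(ps ++ [x w] ++ [x t])) ∧
      distEnergy D (insert t s) x ≤ 2 * broomEnergy F (x r) (ps ++ [x w] ++ [x t]) := by
  rw [Finset.forall_mem_insert] at hx
  have others : (s.erase w).val.map x = x r ::ₘ (F + ps) := by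
    rw [map_update_val hw, ← Multiset.coe_add, Multiset.coe_singleton, ← add_assoc,
      Multiset.add_comm _ {_}, Multiset.singleton_add, Multiset.cons_swap] at weights
    exact (Multiset.cons_inj_right _).1 weights
  have mass : ∑ v ∈ s, x v = x w + (x r + (F.sum + ps.sum)) := by
    change (s.val.map x).sum = _
    rw [map_val_eq_cons_erase hw, others, Multiset.sum_cons, Multiset.sum_cons, Multiset.sum_add,
      Multiset.sum_coe]
  refine ⟨?_, ?_⟩
  · rw [Finset.insert_val_of_notMem ht, Multiset.map_cons, map_val_eq_cons_erase hw, others]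
    simp only [← Multiset.coe_add, Multiset.coe_singleton, ← Multiset.singleton_add]
    abel
  · have merge := distEnergy_insert_le_update_add h.isSymm hw ht (h.diag t) (h.diag w)
      (fun v _ => htw ▸ h.le_par_add_one t htr v) hx.1 hx.2
    rw [mass] at merge
    rw [List.append_assoc, List.singleton_append, broomEnergy_split]
    linarith

theorem exists_distEnergy_le_broomEnergy (h : IsRootedTreeFor D r par dep)
    (hs : IsSubtree r par s) (ht : t ∈ s) (htr : t ≠ r)
    (hleaves : ∀ l ∈ treeLeaves r par s, dep l = 1 ∨ l = t) (hx : ∀ u ∈ s, 0 ≤ x u) :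
    ∃ (F : Multiset ℝ) (ps : List ℝ), F.card + 1 = #{u ∈ s | dep u = 1} ∧
      s.val.map x = x r ::ₘ (F + ↑(ps ++ [x t])) ∧
      distEnergy D s x ≤ 2 * broomEnergy F (x r) (ps ++ [x t]) := by
  induction k : dep t generalizing s t x with
  | zero => exact absurd (h.dep_eq_zero_iff.1 k) htr
  | succ k ih =>
  by_cases shallow : ∀ u ∈ s, dep u ≤ 1
  · exact h.exists_distEnergy_le_broomEnergy_of_forall_dep_le_one hs.root_mem ht htr shallow hx
  push Not at shallow
  obtain ⟨u, hu, hu₁⟩ := shallow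
  obtain ⟨l, hl, deepest⟩ := h.exists_mem_treeLeaves_forall_dep_le hs.root_mem
    ⟨t, ht, r, hs.root_mem, htr⟩
  obtain rfl : l = t := (hleaves l hl).resolve_left (by grind)
  have hw := hs.par_mem_erase hl
  have dep_l := h.dep_eq l htr
  have par_ne_root : par l ≠ r := by
    rw [ne_eq, ← h.dep_eq_zero_iff]
    have := deepest u hu
    omega
  have leaves_erase : ∀ v ∈ treeLeaves r par (s.erase l), dep v = 1 ∨ v = par l := by
    intro v hv
    by_contra! ⟨hv₁, hvl⟩
    have := (hleaves v (mem_treeLeaves_of_mem_erase hv hvl)).resolve_left hv₁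
    exact (Finset.mem_erase.1 (mem_treeLeaves.1 hv).1.2).1 this
  obtain ⟨F, ps, card, weights, le⟩ := ih (hs.erase hl) hw par_ne_root leaves_erase
    (fun v hv => (hx v (Finset.mem_of_mem_erase hv)).trans (le_update_add (w := par l) (hx l ht)))
    (by omega)
  rw [Function.update_self, Function.update_of_ne par_ne_root.symm] at weights le
  have concat := h.distEnergy_le_broomEnergy_concat hw (Finset.notMem_erase l s) htr rfl
    (by rwa [Finset.insert_erase ht]) weights le
  rw [Finset.insert_erase ht] at concat
  refine ⟨F, ps ++ [x (par l)], ?_, concat⟩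
  rw [card, Finset.filter_erase, Finset.erase_eq_of_notMem]
  have := deepest u hu
  grind

theorem hasBetterKite_of_erase {l' : V} (h : IsRootedTreeFor D r par dep) (hs : IsSubtree r par s)
    (hl : l ∈ treeLeaves r par s) (hl' : l' ∈ treeLeaves r par s) (hne : l ≠ l')
    (hcard : 5 ≤ #s) (hx : ∀ u ∈ s, 0 ≤ x u) (hll' : x l ≤ x l')
    (ih : HasBetterKite D (s.erase l) (Function.update x (par l) (x (par l) + x l))) :
    HasBetterKite D s x := by
  have hw := hs.par_mem_erase hl
  rw [mem_treeLeaves] at hl hl'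
  rw [← Finset.insert_erase hl.1.2] at hx ⊢
  refine ih.insert ?_ h.isSymm hw (Finset.notMem_erase l s) (h.diag l) (h.diag (par l))
    (fun v _ => h.le_par_add_one l hl.1.1 v) hx (Finset.mem_erase.2 ⟨hne.symm, hl'.1.2⟩)
    (hl'.2 l hl.1.2 hl.1.1).symm hll'
  rw [Finset.card_erase_of_mem hl.1.2]
  omega

omit [DecidableEq V] in
theorem hasBetterKite_of_star (h : IsRootedTreeFor D r par dep) (hr : r ∈ s) (hcard : #s = 7)
    (hdep : ∀ u ∈ s, dep u ≤ 1) (hx : ∀ u ∈ s, 0 < x u) : HasBetterKite D s x := by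
  classical
  obtain ⟨a, b, c, ps, weights, lt⟩ := exists_broomEnergy_nil_lt_kiteEnergy
    (F := (s.erase r).val.map x) (r := x r) (by simp [hr, hcard])
    (Multiset.forall_mem_map_iff.2 fun u hu => hx u (Finset.mem_of_mem_erase hu)) (hx r hr)
  refine ⟨a, b, c, ps, weights.trans (map_val_eq_cons_erase hr).symm, ?_⟩
  linarith [h.distEnergy_le_broomEnergy_nil hr hdep fun u hu => (hx u hu).le]

theorem hasBetterKite_of_broom (h : IsRootedTreeFor D r par dep) (hs : IsSubtree r par s)
    (hcard : 7 ≤ #s) (hdep : #{u ∈ s | dep u = 1} = 5) (ht : t ∈ s) (htr : t ≠ r)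
    (hleaves : ∀ l ∈ treeLeaves r par s, dep l = 1 ∨ l = t) (hx : ∀ u ∈ s, 0 < x u) :
    HasBetterKite D s x := by
  obtain ⟨F, ps, card_F, weights, le⟩ :=
    h.exists_distEnergy_le_broomEnergy hs ht htr hleaves fun u hu => (hx u hu).le
  have pos : ∀ y ∈ s.val.map x, 0 < y := Multiset.forall_mem_map_iff.2 hx
  have card := congrArg Multiset.card weights
  rw [weights] at pos
  simp only [Multiset.mem_cons, Multiset.mem_add, Multiset.mem_coe] at pos
  simp only [Multiset.card_map, Finset.card_val, Multiset.card_cons, Multiset.card_add,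
    Multiset.coe_card] at card
  obtain ⟨a, b, c, qs, weights', lt⟩ := exists_broomEnergy_lt_kiteEnergy (by omega)
    (fun y hy => pos y (.inr (.inl hy))) (hx r hs.root_mem)
    (fun y hy => (pos y (.inr (.inr hy))).le) (by omega)
  exact ⟨a, b, c, qs, weights'.trans weights.symm, by linarith⟩

theorem hasBetterKite_of_two_leaves {l' : V} (h : IsRootedTreeFor D r par dep)
    (hs : IsSubtree r par s) (hl : l ∈ treeLeaves r par s) (hl' : l' ∈ treeLeaves r par s)
    (hne : l ≠ l') (hcard : 8 ≤ #s) (hdep : 5 ≤ #{u ∈ s | dep u = 1})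
    (hdep' : dep l = 1 ∨ dep l' = 1 → 6 ≤ #{u ∈ s | dep u = 1}) (hx : ∀ u ∈ s, 0 < x u)
    (ih : ∀ t ⊂ s, ∀ y : V → ℝ, IsSubtree r par t → 7 ≤ #t → 5 ≤ #{u ∈ t | dep u = 1} →
      (∀ u ∈ t, 0 < y u) → HasBetterKite D t y) :
    HasBetterKite D s x := by
  wlog lighter : x l ≤ x l' generalizing l l'
  · exact this hl' hl hne.symm (hdep' ∘ Or.symm) (le_of_not_ge lighter)
  have hls := (mem_treeLeaves.1 hl).1.2
  refine h.hasBetterKite_of_erase hs hl hl' hne (by omega) (fun u hu => (hx u hu).le) lighter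
    (ih _ (Finset.erase_ssubset hls) _ (hs.erase hl) ?_ ?_ fun v hv => ?_)
  · rw [Finset.card_erase_of_mem hls]
    omega
  · rw [Finset.filter_erase]
    by_cases hl₁ : dep l = 1
    · exact (Nat.le_sub_one_of_lt (hdep' (.inl hl₁))).trans Finset.pred_card_le_card_erase
    · rwa [Finset.erase_eq_of_notMem (by simp [hl₁])]
  · exact (hx v (Finset.mem_of_mem_erase hv)).trans_le (le_update_add (hx l hls).le)

omit [DecidableEq V] in
theorem hasBetterKite (h : IsRootedTreeFor D r par dep) (hs : IsSubtree r par s) (hcard : 7 ≤ #s)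
    (hdep : 5 ≤ #{u ∈ s | dep u = 1}) (hx : ∀ u ∈ s, 0 < x u) : HasBetterKite D s x := by
  classical
  induction s using Finset.strongInduction generalizing x with
  | H s ih =>
  have card_split := Finset.card_filter_add_card_filter_not (s := s) (fun u => dep u = 1)
  rcases hdep.eq_or_lt with h₅ | h₆
  · obtain ⟨t, ht, deepest⟩ := h.exists_mem_treeLeaves_forall_dep_le hs.root_mem
      (Finset.one_lt_card_iff_nontrivial.1 (by omega))
    obtain ⟨htr, hts⟩ := (mem_treeLeaves.1 ht).1
    by_cases broom : ∀ l ∈ treeLeaves r par s, dep l = 1 ∨ l = t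
    · exact h.hasBetterKite_of_broom hs hcard h₅.symm hts htr broom hx
    push Not at broom
    obtain ⟨l, hl, hl₁, hlt⟩ := broom
    obtain ⟨hlr, hls⟩ := (mem_treeLeaves.1 hl).1
    have ht₁ : dep t ≠ 1 := by
      have := deepest l hls
      have := h.dep_eq_zero_iff.not.2 hlr
      omega
    have three : 2 < #{u ∈ s | ¬dep u = 1} := Finset.two_lt_card.2
      ⟨r, by simp [hs.root_mem, h.dep_root], l, by simp [hls, hl₁], t, by simp [hts, ht₁],
        hlr.symm, htr.symm, hlt⟩
    exact h.hasBetterKite_of_two_leaves hs hl ht hlt (by omega) hdep (by tauto) hx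
      fun s' hs' _ => ih s' hs'
  rcases hcard.eq_or_lt with h₇ | h₈
  · refine h.hasBetterKite_of_star hs.root_mem h₇.symm (fun u hu => ?_) hx
    by_contra! hu₁
    have two : 1 < #{u ∈ s | ¬dep u = 1} := Finset.one_lt_card.2
      ⟨r, by simp [hs.root_mem, h.dep_root], u, by grind, by grind [h.dep_root]⟩
    omega
  · obtain ⟨l, hl, l', hl', hne⟩ := Finset.one_lt_card.1
      ((by omega : 1 < _).trans_le (h.card_dep_one_le_card_treeLeaves (s := s)))
    exact h.hasBetterKite_of_two_leaves hs hl hl' hne h₈ hdep (fun _ => h₆) hx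
      fun s' hs' _ => ih s' hs'

end IsRootedTreeFor

end RootedTree

section KiteGraph

theorem kiteEnergy_split (a b c w l : ℝ) (xs : List ℝ) :
    kiteEnergy a b c (xs ++ [w, l]) =
      kiteEnergy a b c (xs ++ [w + l]) + l * (a + b + c + xs.sum + w) := by
  rw [kiteEnergy, kiteEnergy, pathEnergy_split _ w l xs [], List.sum_nil]
  ring

/-- The distance of the vertices `i` and `j` of a kite with a `4`-clique. On the path, which starts
at the clique vertex `3`, the distance to each of the clique vertices `0, 1, 2` off the path is the
one to the position of `2`, whence the truncated `i - 2` and `j - 2`. -/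
def kiteDist (i j : ℕ) : ℕ :=
  if i = j then 0 else if i < 3 ∧ j < 3 then 1 else (i - 2 - (j - 2)) + (j - 2 - (i - 2))

theorem kiteDist_comm (i j : ℕ) : kiteDist i j = kiteDist j i := by
  unfold kiteDist; split_ifs <;> omega

theorem kiteDist_self (i : ℕ) : kiteDist i i = 0 := if_pos rfl

theorem kiteDist_succ_left {i j : ℕ} (hi : 3 ≤ i) (hj : j ≤ i) :
    kiteDist (i + 1) j = kiteDist i j + 1 := by
  unfold kiteDist; split_ifs <;> omega

theorem kiteDist_le_length {n : ℕ} {i j : Fin n} (p : (kiteGraph 4 n).Walk i j) :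
    kiteDist i j ≤ p.length := by
  induction p with
  | nil => simp [kiteDist_self]
  | @cons u v w huv p ih =>
    obtain ⟨hne, h⟩ := huv
    have hne : (u : ℕ) ≠ v := Fin.val_ne_of_ne hne
    have step : kiteDist u w ≤ kiteDist v w + 1 := by unfold kiteDist; split_ifs <;> omega
    exact step.trans (Nat.add_le_add_right ih 1)

theorem kiteGraph_connected (k n : ℕ) : (kiteGraph k (n + 1)).Connected := by
  have reachable : ∀ i, (kiteGraph k (n + 1)).Reachable 0 i :=
    Fin.induction .rfl fun i ih =>
      ih.trans (SimpleGraph.Adj.reachable ⟨Fin.castSucc_lt_succ.ne, .inr (.inl rfl)⟩)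
  exact ⟨fun i j => (reachable i).symm.trans (reachable j)⟩

theorem kiteDist_le_dist {n : ℕ} (i j : Fin n) : kiteDist i j ≤ (kiteGraph 4 n).dist i j := by
  obtain _ | n := n
  · exact i.elim0
  obtain ⟨p, hp⟩ := (kiteGraph_connected 4 n).exists_walk_length_eq_dist i j
  exact hp ▸ kiteDist_le_length p

theorem distEnergy_kiteDist_range (n : ℕ) (y : ℕ → ℝ) :
    distEnergy (Matrix.of fun i j => (kiteDist i j : ℝ)) (Finset.range (n + 3)) y =
      2 * kiteEnergy (y 0) (y 1) (y 2) ((List.range n).map fun i => y (i + 3)) := by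
  induction n using Nat.twoStepInduction generalizing y with
  | zero =>
    simp only [distEnergy, Finset.sum_range_succ, Finset.sum_range_zero, Matrix.of_apply, kiteDist,
      List.range_zero, List.map_nil, kiteEnergy, pathEnergy]
    norm_num
    ring
  | one =>
    simp only [distEnergy, Finset.sum_range_succ, Finset.sum_range_zero, Matrix.of_apply, kiteDist,
      List.range_one, List.map_cons, List.map_nil, List.sum_nil, kiteEnergy, pathEnergy]
    norm_num
    ring
  | more n _ ih =>
    have farther : ∀ v ∈ Finset.range (n + 4),
        ((kiteDist (n + 4) v : ℝ) - kiteDist (n + 3) v) * y v = y v := fun v hv => by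
      rw [kiteDist_succ_left (by omega) (by grind), Nat.cast_add_one, add_sub_cancel_left, one_mul]
    have mass : ∑ v ∈ Finset.range (n + 4), y v =
        y 0 + y 1 + y 2 + ((List.range n).map fun i => y (i + 3)).sum + y (n + 3) := by
      rw [Finset.sum_range_succ, Finset.sum_range_succ', Finset.sum_range_succ',
        Finset.sum_range_succ']
      change (∑ i ∈ Finset.range n, y (i + 3)) + _ + _ + _ + _ =
        _ + (∑ i ∈ Finset.range n, y (i + 3)) + _
      ring
    have path : ((List.range n).map fun i =>
        Function.update y (n + 3) (y (n + 3) + y (n + 4)) (i + 3)) =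
          (List.range n).map fun i => y (i + 3) :=
      List.map_congr_left fun i hi => Function.update_of_ne (by grind) ..
    rw [Finset.range_add_one, distEnergy_insert_eq_update_add (w := n + 3)
      (Matrix.IsSymm.ext fun i j => by simp [kiteDist_comm]) (by simp) (by simp)
      (by simp [kiteDist_self]) (by simp [kiteDist_self]), ih]
    simp only [Matrix.of_apply, Finset.sum_congr rfl farther, mass, List.range_succ,
      List.map_append, List.map_cons, List.map_nil, List.append_assoc, List.singleton_append, path,
      kiteEnergy_split, Function.update_self, mul_add,
      Function.update_of_ne (by omega : 0 ≠ n + 3), Function.update_of_ne (by omega : 1 ≠ n + 3),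
      Function.update_of_ne (by omega : 2 ≠ n + 3)]

end KiteGraph

section Spectral

open Matrix

variable {V : Type*} [Fintype V] {A : Matrix V V ℝ} {c : ℝ} {x : V → ℝ}

theorem distEnergy_univ_eq_dotProduct : distEnergy A Finset.univ x = x ⬝ᵥ A *ᵥ x := by
  simp only [distEnergy, dotProduct, mulVec, Finset.mul_sum, mul_left_comm]

theorem distEnergy_univ_of_mulVec_eq_smul (h : A *ᵥ x = c • x) :
    distEnergy A Finset.univ x = c * ∑ u, x u ^ 2 := by
  rw [distEnergy_univ_eq_dotProduct, h, dotProduct_smul, smul_eq_mul]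
  simp only [dotProduct, sq]

theorem pos_of_mulVec_eq_smul (hA : ∀ u v, u ≠ v → 0 < A u v) (hdiag : ∀ u, 0 ≤ A u u)
    (hx : 0 < x) (h : A *ᵥ x = c • x) (u : V) : 0 < x u := by
  obtain ⟨nonneg, v, hv⟩ := Pi.lt_def.1 hx
  refine (nonneg u).lt_of_ne' fun hu => ?_
  have row : ∑ w, A u w * x w = 0 := by
    simpa only [mulVec, dotProduct, Pi.smul_apply, Pi.zero_apply, hu, smul_zero] using congrFun h u
  have term_nonneg : ∀ w ∈ Finset.univ, 0 ≤ A u w * x w := fun w _ => by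
    refine mul_nonneg ?_ (nonneg w)
    rcases eq_or_ne u w with rfl | huw
    exacts [hdiag u, (hA u w huw).le]
  have huv : u ≠ v := by
    rintro rfl
    exact hv.ne' hu
  have := (Finset.sum_eq_zero_iff_of_nonneg term_nonneg).1 row v (Finset.mem_univ v)
  exact (mul_pos (hA u v huv) hv).ne' this

variable [DecidableEq V]

theorem posSemidef_smul_one_sub (hA : A.IsHermitian) (hc : ∀ t ∈ spectrum ℝ A, t ≤ c) :
    (c • (1 : Matrix V V ℝ) - A).PosSemidef := by
  rw [posSemidef_iff_isHermitian_and_spectrum_nonneg]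
  refine ⟨(isHermitian_one.smul (IsSelfAdjoint.all c)).sub hA, ?_⟩
  rw [← Algebra.algebraMap_eq_smul_one, ← spectrum.singleton_sub_eq, Set.singleton_sub]
  rintro _ ⟨t, ht, rfl⟩
  exact sub_nonneg.2 (hc t ht)

theorem dotProduct_smul_one_sub_mulVec :
    star x ⬝ᵥ (c • (1 : Matrix V V ℝ) - A) *ᵥ x =
      c * ∑ u, x u ^ 2 - distEnergy A Finset.univ x := by
  rw [sub_mulVec, smul_mulVec, one_mulVec, dotProduct_sub, dotProduct_smul, star_trivial,
    distEnergy_univ_eq_dotProduct]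
  simp only [dotProduct, sq, smul_eq_mul]

theorem distEnergy_univ_le (hA : A.IsHermitian) (hc : ∀ t ∈ spectrum ℝ A, t ≤ c) (x : V → ℝ) :
    distEnergy A Finset.univ x ≤ c * ∑ u, x u ^ 2 := by
  rw [← sub_nonneg, ← dotProduct_smul_one_sub_mulVec]
  exact (posSemidef_smul_one_sub hA hc).dotProduct_mulVec_nonneg x

theorem mulVec_eq_smul_of_le_distEnergy (hA : A.IsHermitian) (hc : ∀ t ∈ spectrum ℝ A, t ≤ c)
    (h : c * ∑ u, x u ^ 2 ≤ distEnergy A Finset.univ x) : A *ᵥ x = c • x := by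
  have zero := ((posSemidef_smul_one_sub hA hc).dotProduct_mulVec_zero_iff x).1 (by
    rw [dotProduct_smul_one_sub_mulVec, h.antisymm' (distEnergy_univ_le hA hc x), sub_self])
  rw [sub_mulVec, smul_mulVec, one_mulVec, sub_eq_zero] at zero
  exact zero.symm

theorem exists_mulVec_eq_smul_of_mem_spectrum (hc : c ∈ spectrum ℝ A) :
    ∃ x ≠ 0, A *ᵥ x = c • x := by
  rw [← spectrum_toLin', ← Module.End.hasEigenvalue_iff_mem_spectrum] at hc
  obtain ⟨x, hx⟩ := hc.exists_hasEigenvector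
  exact ⟨x, hx.2, by simpa only [toLin'_apply] using hx.apply_eq_smul⟩

theorem exists_pos_mulVec_eq_smul (hA : A.IsHermitian) (hpos : ∀ u v, u ≠ v → 0 < A u v)
    (hdiag : ∀ u, 0 ≤ A u u) (hc : IsGreatest (spectrum ℝ A) c) :
    ∃ x : V → ℝ, (∀ u, 0 < x u) ∧ A *ᵥ x = c • x := by
  obtain ⟨x, hx, eigen⟩ := exists_mulVec_eq_smul_of_mem_spectrum hc.1
  have energy_le_abs : distEnergy A Finset.univ x ≤ distEnergy A Finset.univ |x| := by
    refine Finset.sum_le_sum fun u _ => Finset.sum_le_sum fun v _ => ?_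
    have entry_nonneg : 0 ≤ A u v := by
      rcases eq_or_ne u v with rfl | huv
      exacts [hdiag u, (hpos u v huv).le]
    rw [Pi.abs_apply, Pi.abs_apply, ← abs_mul]
    exact mul_le_mul_of_nonneg_left (le_abs_self _) entry_nonneg
  have eigen_abs : A *ᵥ |x| = c • |x| := by
    refine mulVec_eq_smul_of_le_distEnergy hA hc.2 ?_
    simpa only [Pi.abs_apply, sq_abs, ← distEnergy_univ_of_mulVec_eq_smul eigen]
  have abs_pos : 0 < |x| := (abs_nonneg x).lt_of_ne' (by simpa using hx)
  exact ⟨|x|, pos_of_mulVec_eq_smul hpos hdiag abs_pos eigen_abs, eigen_abs⟩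

end Spectral

section DistSpectralRadius

open scoped Finset

theorem isRootedTreeFor_distMatrix_of_adj {V : Type*} {G : SimpleGraph V} (hG : G.Connected) {r : V}
    {par : V → V} (hadj : ∀ u ≠ r, G.Adj u (par u))
    (hdist : ∀ u ≠ r, G.dist r u = G.dist r (par u) + 1) :
    IsRootedTreeFor G.distMatrix r par (G.dist r) where
  dep_root := G.dist_self
  dep_eq := hdist
  isSymm := by simpa using G.distMatrix_isHermitian
  diag u := by simp [SimpleGraph.distMatrix]
  le_par_add_one u hu v := by
    have triangle := hG.dist_triangle (u := u) (v := par u) (w := v)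
    rw [SimpleGraph.dist_eq_one_iff_adj.2 (hadj u hu), add_comm] at triangle
    simp only [SimpleGraph.distMatrix, Matrix.of_apply]
    exact_mod_cast triangle

theorem exists_adj_dist_eq_add_one {V : Type*} {G : SimpleGraph V} (hG : G.Connected) {r u : V}
    (hu : u ≠ r) : ∃ w, G.Adj u w ∧ G.dist r u = G.dist r w + 1 := by
  obtain ⟨p, hp⟩ := hG.exists_walk_length_eq_dist u r
  cases p with
  | nil => exact absurd rfl hu
  | @cons _ w _ huw p =>
    rw [SimpleGraph.Walk.length_cons] at hp
    have le := G.dist_le p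
    have triangle := hG.dist_triangle (u := u) (v := w) (w := r)
    rw [SimpleGraph.dist_eq_one_iff_adj.2 huw] at triangle
    refine ⟨w, huw, ?_⟩
    rw [G.dist_comm (u := r), G.dist_comm (u := r)]
    omega

theorem exists_isRootedTreeFor_distMatrix {V : Type*} {G : SimpleGraph V} (hG : G.Connected)
    (r : V) : ∃ par : V → V, IsRootedTreeFor G.distMatrix r par (G.dist r) := by
  classical
  choose! par adj dist using fun u (hu : u ≠ r) => exists_adj_dist_eq_add_one hG hu
  exact ⟨par, isRootedTreeFor_distMatrix_of_adj hG adj dist⟩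

variable {V : Type*} [Fintype V] [DecidableEq V] {G : SimpleGraph V}

theorem exists_pos_distEnergy_eq_distSpectralRadius (hG : G.Connected) :
    ∃ x : V → ℝ, (∀ u, 0 < x u) ∧
      distEnergy G.distMatrix Finset.univ x = G.distSpectralRadius * ∑ u, x u ^ 2 := by
  have := hG.nonempty
  obtain ⟨x, pos, eigen⟩ := exists_pos_mulVec_eq_smul G.distMatrix_isHermitian
    (fun u v huv => Nat.cast_pos.2 (hG.pos_dist_of_ne huv)) (fun u => Nat.cast_nonneg _)
    G.distSpectralRadius_isGreatest
  exact ⟨x, pos, distEnergy_univ_of_mulVec_eq_smul eigen⟩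

theorem two_mul_kiteEnergy_le {n : ℕ} {a b c : ℝ} {ps : List ℝ} (hn : ps.length + 3 = n)
    (hps : ∀ y ∈ a :: b :: c :: ps, 0 ≤ y) :
    2 * kiteEnergy a b c ps ≤
      (kiteGraph 4 n).distSpectralRadius * ((a :: b :: c :: ps).map (· ^ 2)).sum := by
  subst hn
  set y : ℕ → ℝ := fun i => (a :: b :: c :: ps).getD i 0
  have weights : List.ofFn (fun i : Fin (ps.length + 3) => y i) = a :: b :: c :: ps :=
    List.ext_getElem (by simp) (by simp [y])
  have path : (List.range ps.length).map (fun i => y (i + 3)) = ps :=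
    List.ext_getElem (by simp) (by simp +contextual [y])
  have energy := distEnergy_kiteDist_range ps.length y
  rw [path] at energy
  have squares : ∑ i : Fin (ps.length + 3), y i ^ 2 =
      ((a :: b :: c :: ps).map (· ^ 2)).sum := by
    rw [← weights, List.map_ofFn, List.sum_ofFn]
    rfl
  have nonneg : ∀ i : Fin (ps.length + 3), 0 ≤ y i := fun i =>
    hps _ (weights ▸ List.mem_ofFn.2 ⟨i, rfl⟩)
  change 2 * kiteEnergy (y 0) (y 1) (y 2) ps ≤ _
  rw [← energy, ← squares]
  refine le_trans ?_ (distEnergy_univ_le (kiteGraph 4 _).distMatrix_isHermitian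
    (kiteGraph 4 _).distSpectralRadius_isGreatest.2 fun i => y i)
  simp only [distEnergy, Finset.sum_range]
  exact Finset.sum_le_sum fun i _ => Finset.sum_le_sum fun j _ =>
    mul_le_mul_of_nonneg_right (Nat.cast_le.2 (kiteDist_le_dist i j))
      (mul_nonneg (nonneg i) (nonneg j))

theorem lt_distSpectralRadius_kiteGraph_six :
    43 / 5 < (kiteGraph 4 6).distSpectralRadius := by
  have bound := two_mul_kiteEnergy_le (n := 6) (a := 4) (b := 4) (c := 4) (ps := [3, 4, 5]) rfl
    (by simp)
  norm_num [kiteEnergy, pathEnergy] at bound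
  linarith

theorem two_mul_broomEnergy_nil_le {ι : Type*} {s : Finset ι} (hs : #s = 5) (x : ι → ℝ) (r : ℝ) :
    2 * broomEnergy (s.val.map x) r [] ≤ 43 / 5 * (r ^ 2 + ∑ u ∈ s, x u ^ 2) := by
  have cauchy := sq_sum_le_card_mul_sum_sq (s := s) (f := x)
  rw [hs, Nat.cast_ofNat] at cauchy
  simp only [broomEnergy, pathEnergy, List.sum_nil, Multiset.map_map]
  change 2 * ((∑ u ∈ s, x u) ^ 2 - (∑ u ∈ s, x u ^ 2) + ((∑ u ∈ s, x u) * (r + 0) + 0)) ≤ _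
  nlinarith [sq_nonneg (43 * r - 5 * ∑ u ∈ s, x u), sq_nonneg (∑ u ∈ s, x u)]

omit [DecidableEq V] in
theorem card_dist_eq_one [DecidableRel G.Adj] (r : V) : #{u | G.dist r u = 1} = G.degree r := by
  simp only [SimpleGraph.dist_eq_one_iff_adj, ← SimpleGraph.card_neighborFinset_eq_degree,
    SimpleGraph.neighborFinset_eq_filter]

omit [DecidableEq V] in
theorem isUniversal_of_card_le_degree_add_one [DecidableRel G.Adj] {r : V}
    (h : Fintype.card V ≤ G.degree r + 1) : G.IsUniversal r := by
  classical
  intro u hu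
  have neighbors : G.neighborFinset r = Finset.univ.erase r :=
    Finset.eq_of_subset_of_card_le
      (fun v hv => by simpa using ((G.mem_neighborFinset r v).1 hv).ne') (by simp [h])
  rw [← G.mem_neighborFinset, neighbors]
  simpa using hu.symm

theorem distSpectralRadius_le_of_isUniversal {r : V} (hr : G.IsUniversal r)
    (hcard : Fintype.card V = 6) : G.distSpectralRadius ≤ 43 / 5 := by
  have hG := SimpleGraph.Connected.of_isUniversal hr
  have dist_le : ∀ u, G.dist r u ≤ 1 := fun u => by
    rcases eq_or_ne r u with rfl | hru
    · simp
    · exact (SimpleGraph.dist_eq_one_iff_adj.2 (hr hru)).le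
  obtain ⟨x, hx, energy⟩ := exists_pos_distEnergy_eq_distSpectralRadius hG
  obtain ⟨par, tree⟩ := exists_isRootedTreeFor_distMatrix hG r
  have star := tree.distEnergy_le_broomEnergy_nil (Finset.mem_univ r) (fun u _ => dist_le u)
    fun u _ => (hx u).le
  have bound := two_mul_broomEnergy_nil_le (s := Finset.univ.erase r) (by simp [hcard]) x (x r)
  rw [Finset.add_sum_erase _ (fun u => x u ^ 2) (Finset.mem_univ r)] at bound
  refine le_of_mul_le_mul_right (energy.symm.le.trans (star.trans bound)) ?_
  exact Finset.sum_pos (fun u _ => pow_pos (hx u) 2) ⟨r, Finset.mem_univ r⟩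

omit [DecidableEq V] in
theorem HasBetterKite.lt_distSpectralRadius [Nonempty V] {D : Matrix V V ℝ} {x : V → ℝ} {ρ : ℝ}
    (h : HasBetterKite D Finset.univ x) (hx : ∀ u, 0 < x u)
    (hρ : distEnergy D Finset.univ x = ρ * ∑ u, x u ^ 2) :
    ρ < (kiteGraph 4 (Fintype.card V)).distSpectralRadius := by
  obtain ⟨a, b, c, ps, weights, lt⟩ := h
  have card := congrArg Multiset.card weights
  have squares : ((a :: b :: c :: ps).map (· ^ 2)).sum = ∑ u, x u ^ 2 := by
    rw [← Multiset.sum_coe, ← Multiset.map_coe, weights, Multiset.map_map]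
    rfl
  have kite := two_mul_kiteEnergy_le (n := Fintype.card V) (by simpa using card) fun y hy => by
    rw [← Multiset.mem_coe, weights] at hy
    obtain ⟨u, -, rfl⟩ := Multiset.mem_map.1 hy
    exact (hx u).le
  rw [squares] at kite
  rw [hρ] at lt
  exact lt_of_mul_lt_mul_right (lt.trans_le kite) (Finset.sum_nonneg fun u _ => sq_nonneg (x u))

end DistSpectralRadius

theorem mainTheorem5 {V : Type*} [Fintype V] [DecidableEq V] (G : SimpleGraph V)
    [DecidableRel G.Adj] (n : ℕ) (hn : Fintype.card V = n) (hG : G.Connected)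
    (hΔ : 5 ≤ G.maxDegree) :
    G.distSpectralRadius < (kiteGraph 4 n).distSpectralRadius := by
  have := hG.nonempty
  subst hn
  obtain ⟨r, hr⟩ := G.exists_maximal_degree_vertex
  rw [hr] at hΔ
  have six_le : 6 ≤ Fintype.card V := hΔ.trans_lt (G.degree_lt_card_verts r)
  rcases six_le.eq_or_lt with h₆ | h₇
  · have universal := isUniversal_of_card_le_degree_add_one (h₆.ge.trans (Nat.succ_le_succ hΔ))
    rw [← h₆]
    exact (distSpectralRadius_le_of_isUniversal universal h₆.symm).trans_lt
      lt_distSpectralRadius_kiteGraph_six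
  · obtain ⟨x, hx, energy⟩ := exists_pos_distEnergy_eq_distSpectralRadius hG
    obtain ⟨par, tree⟩ := exists_isRootedTreeFor_distMatrix hG r
    have kite := tree.hasBetterKite ⟨Finset.mem_univ r, fun _ _ _ => Finset.mem_univ _⟩ h₇
      (hΔ.trans_eq (card_dist_eq_one r).symm) fun u _ => hx u
    exact kite.lt_distSpectralRadius hx energy
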